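/- Let $m\ge 2$ and let $A=(a_{i_1\cdots i_m})_{1\le i_1,\dots,i_m\le n}$ be a real tensor of order $m$ and dimension $n$. For a vector $x\in\mathbb{C}^n$ let $Ax^{m-1}\in\mathbb{C}^n$ be the vector with entries $$(Ax^{m-1})_i=\sum_{i_2,\dots,i_m=1}^n a_{ii_2\cdots i_m}x_{i_2}\cdots x_{i_m}.$$ A number $\lambda\in\mathbb{C}$ is an eigenvalue of $A$ if there is $x\in\mathbb{C}^n\setminus\{0\}$ with $(Ax^{m-1})_i=\lambda x_i^{m-1}$ for all $i$, and the spectral radius $\rho(A)$ is the largest modulus of an eigenvalue of $A$. The tensor $A$ is a strong M-tensor if $A=sI-B$ for some tensor $B$ (of the same order and dimension) with nonnegative entries and some real $s>\rho(B)$, where $I$ is the identity tensor (ones on the diagonal $i_1=\cdots=i_m$, zeros elsewhere). Corollary. Let $A$ be a strong M-tensor. Then there exists a map $A_+^{-1}:\mathbb{R}_+^n\to\mathbb{R}_+^n$, where $\mathbb{R}_+^n=[0,\infty)^n$, that is nondecreasing with respect to the coordinatewise order (if $0\le b\le b'$ then $A_+^{-1}(b)\le A_+^{-1}(b')$) and such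 that for every $b\in\mathbb{R}_+^n$ the nonnegative vector $x=A_+^{-1}(b)$ is a solution of the tensor equation $Ax^{m-1}=b$. -/

import Mathlib

/-- Real tensors of order `m` and dimension `n`: families `a_{i₁ ⋯ iₘ}` of real numbers. -/
abbrev RealTensor (m n : ℕ) : Type := (Fin m → Fin n) → ℝ

namespace RealTensor

/-- The identity tensor: ones on the diagonal (all indices equal), zeros elsewhere. -/
def identity (m n : ℕ) : RealTensor m n :=
  fun J => if ∀ p q, J p = J q then 1 else 0

/-- For a tensor `A` of order `m = k + 1`, the vector `A x ^ (m - 1)`, whose `i`-th entry is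
`∑ a_{i i₂ ⋯ iₘ} x_{i₂} ⋯ x_{iₘ}`. It is used for real vectors and for complex vectors. -/
def mulPow {k n : ℕ} {R : Type*} [CommRing R] [Algebra ℝ R]
    (A : RealTensor (k + 1) n) (x : Fin n → R) : Fin n → R :=
  fun i => ∑ j : Fin k → Fin n, A (Fin.cons i j) • ∏ l, x (j l)

/-- `c` is an eigenvalue of `A` (of order `m = k + 1`): `A x ^ (m - 1) = c x ^ [m - 1]` for some
nonzero complex vector `x`, where `x ^ [m - 1]` is the coordinatewise power. -/
def IsEigenvalue {k n : ℕ} (A : RealTensor (k + 1) n) (c : ℂ) : Prop :=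
  ∃ x : Fin n → ℂ, x ≠ 0 ∧ ∀ i, A.mulPow x i = c * x i ^ k

/-- The largest modulus of an eigenvalue. The set of moduli is bounded, see
`bddAbove_norm_eigenvalues` below. In dimension zero there are no eigenvalues, and the
value is `0`. -/
noncomputable def spectralRadius {k n : ℕ} (A : RealTensor (k + 1) n) : ℝ :=
  sSup {r : ℝ | ∃ c : ℂ, A.IsEigenvalue c ∧ r = ‖c‖}

theorem bddAbove_norm_eigenvalues {k n : ℕ} (A : RealTensor (k + 1) n) :
    BddAbove {r : ℝ | ∃ c : ℂ, A.IsEigenvalue c ∧ r = ‖c‖} := by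
  refine ⟨∑ i, ∑ j : Fin k → Fin n, |A (Fin.cons i j)|, ?_⟩
  rintro r ⟨c, ⟨x, hx, h⟩, rfl⟩
  obtain ⟨i₀, hi₀⟩ := Function.ne_iff.mp hx
  obtain ⟨i, -, hi⟩ := Finset.exists_max_image Finset.univ (fun i => ‖x i‖) ⟨i₀, Finset.mem_univ _⟩
  have hpos : 0 < ‖x i‖ := lt_of_lt_of_le (norm_pos_iff.mpr hi₀) (hi i₀ (Finset.mem_univ _))
  have h1 : ‖c‖ * ‖x i‖ ^ k ≤ (∑ j : Fin k → Fin n, |A (Fin.cons i j)|) * ‖x i‖ ^ k := by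
    rw [← norm_pow, ← norm_mul, ← h i, Finset.sum_mul]
    refine (norm_sum_le _ _).trans (Finset.sum_le_sum fun j _ => ?_)
    rw [norm_smul, Real.norm_eq_abs, norm_prod, norm_pow]
    gcongr
    calc ∏ l, ‖x (j l)‖ ≤ ∏ _l : Fin k, ‖x i‖ :=
          Finset.prod_le_prod (fun _ _ => norm_nonneg _) (fun l _ => hi _ (Finset.mem_univ _))
      _ = ‖x i‖ ^ k := by simp
  refine (le_of_mul_le_mul_right h1 (pow_pos hpos k)).trans ?_
  exact Finset.single_le_sum (f := fun i => ∑ j : Fin k → Fin n, |A (Fin.cons i j)|)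
    (fun i _ => Finset.sum_nonneg fun j _ => abs_nonneg _) (Finset.mem_univ i)

/-- `A` is a strong M-tensor: `A = s I - B` with `B` entrywise nonnegative and `s` larger than the
spectral radius of `B`. -/
def IsStrongMTensor {k n : ℕ} (A : RealTensor (k + 1) n) : Prop :=
  ∃ (B : RealTensor (k + 1) n) (s : ℝ),
    (∀ J, 0 ≤ B J) ∧ B.spectralRadius < s ∧ A = s • identity (k + 1) n - B

end RealTensor

namespace RealTensor

open Filter Topology

variable {k n : ℕ}

/-! With `A = s I - B`, the equation reads `B x ^ (m - 1) + b = s x ^ [m - 1]`. Its left side is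
monotone in `x ≥ 0`, so the coordinatewise infimum of the supersolutions is a solution
(`sInf_superSolutions_spec`), as in Knaster–Tarski. Enlarging `b` shrinks the set of supersolutions,
so this infimum is monotone in `b`.

What remains is that supersolutions exist for `s > ρ(B)`; by homogeneity `b = 1` suffices. The
parameters admitting one form an upper set that does not contain its infimum. Normalized solutions
for parameters tending to this infimum converge to a nonnegative eigenvector, so the infimum is an
eigenvalue of `B` and is at most `ρ(B)`. -/

theorem mulPow_mono {B : RealTensor (k + 1) n} (hB : ∀ J, 0 ≤ B J) {x y : Fin n → ℝ}
    (hx : 0 ≤ x) (hxy : x ≤ y) (i : Fin n) : B.mulPow x i ≤ B.mulPow y i := by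
  unfold mulPow
  refine Finset.sum_le_sum fun j _ => ?_
  simp only [smul_eq_mul]
  exact mul_le_mul_of_nonneg_left
    (Finset.prod_le_prod (fun l _ => hx (j l)) fun l _ => hxy (j l)) (hB _)

theorem mulPow_nonneg {B : RealTensor (k + 1) n} (hB : ∀ J, 0 ≤ B J) {x : Fin n → ℝ}
    (hx : 0 ≤ x) (i : Fin n) : 0 ≤ B.mulPow x i :=
  Finset.sum_nonneg fun j _ =>
    mul_nonneg (hB _) (Finset.prod_nonneg fun l _ => hx (j l))

theorem mulPow_smul (B : RealTensor (k + 1) n) (c : ℝ) (x : Fin n → ℝ) (i : Fin n) :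
    B.mulPow (c • x) i = c ^ k * B.mulPow x i := by
  simp only [mulPow, Finset.mul_sum, Pi.smul_apply, smul_eq_mul, Finset.prod_mul_distrib,
    Finset.prod_const, Finset.card_univ, Fintype.card_fin]
  exact Finset.sum_congr rfl fun j _ => by ring

theorem continuous_mulPow (B : RealTensor (k + 1) n) (i : Fin n) :
    Continuous fun x : Fin n → ℝ => B.mulPow x i := by
  unfold mulPow
  fun_prop

theorem mulPow_ofReal (B : RealTensor (k + 1) n) (x : Fin n → ℝ) (i : Fin n) :
    B.mulPow (fun j => (x j : ℂ)) i = ((B.mulPow x i : ℝ) : ℂ) := by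
  simp [mulPow]

theorem mulPow_identity (x : Fin n → ℝ) (i : Fin n) :
    (identity (k + 1) n).mulPow x i = x i ^ k := by
  unfold mulPow
  rw [Finset.sum_eq_single fun _ => i]
  · have h : ∀ p : Fin (k + 1), (Fin.cons i (fun _ => i) : Fin (k + 1) → Fin n) p = i :=
      fun p => Fin.cases rfl (fun _ => rfl) p
    simp [identity, h]
  · intro j _ hj
    have h : ¬ ∀ p q, (Fin.cons i j : Fin (k + 1) → Fin n) p
        = (Fin.cons i j : Fin (k + 1) → Fin n) q := fun h =>
      hj (funext fun l => by simpa using h l.succ 0)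
    simp [identity, h]
  · simp

theorem mulPow_smul_identity_sub (B : RealTensor (k + 1) n) (s : ℝ) (x : Fin n → ℝ)
    (i : Fin n) :
    (s • identity (k + 1) n - B).mulPow x i = s * x i ^ k - B.mulPow x i := by
  rw [← mulPow_identity x i]
  simp [mulPow, sub_mul, Finset.sum_sub_distrib, Finset.mul_sum, mul_assoc]

theorem spectralRadius_nonneg (B : RealTensor (k + 1) n) : 0 ≤ B.spectralRadius :=
  Real.sSup_nonneg (by
    rintro _ ⟨_, _, rfl⟩
    exact norm_nonneg _)

/-- A nonnegative eigenvalue with a real eigenvector bounds the spectral radius from below. -/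
theorem le_spectralRadius (B : RealTensor (k + 1) n) {r : ℝ} (hr : 0 ≤ r) {y : Fin n → ℝ}
    (hy : y ≠ 0) (h : ∀ i, B.mulPow y i = r * y i ^ k) : r ≤ B.spectralRadius := by
  refine le_csSup (bddAbove_norm_eigenvalues B) ⟨(r : ℂ), ⟨fun j => (y j : ℂ), ?_, fun i => ?_⟩, ?_⟩
  · exact fun h0 => hy (funext fun j => by simpa using congrFun h0 j)
  · rw [mulPow_ofReal, h i]
    push_cast
    rfl
  · simp [abs_of_nonneg hr]

/-- The nonnegative vectors `u` with `B u ^ (m - 1) + b ≤ s u ^ [m - 1]`. -/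
def superSolutions (B : RealTensor (k + 1) n) (s : ℝ) (b : Fin n → ℝ) : Set (Fin n → ℝ) :=
  {u | 0 ≤ u ∧ ∀ i, B.mulPow u i + b i ≤ s * u i ^ k}

theorem bddBelow_superSolutions (B : RealTensor (k + 1) n) (s : ℝ) (b : Fin n → ℝ) :
    BddBelow (B.superSolutions s b) :=
  ⟨0, fun _ hu => hu.1⟩

/-- The infimum of the supersolutions is a solution. -/
theorem sInf_superSolutions_spec (hk : 1 ≤ k) {B : RealTensor (k + 1) n} (hB : ∀ J, 0 ≤ B J)
    {s : ℝ} (hs : 0 < s) {b : Fin n → ℝ} (hb : 0 ≤ b) (hne : (B.superSolutions s b).Nonempty) :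
    0 ≤ sInf (B.superSolutions s b) ∧
      ∀ i, B.mulPow (sInf (B.superSolutions s b)) i + b i
        = s * sInf (B.superSolutions s b) i ^ k := by
  have hk0 : k ≠ 0 := by omega
  set x := sInf (B.superSolutions s b) with hx
  have hx0 : 0 ≤ x := le_csInf hne fun u hu => hu.1
  have hxle : ∀ u ∈ B.superSolutions s b, x ≤ u := fun u hu =>
    csInf_le (bddBelow_superSolutions B s b) hu
  -- `w` is one step of the fixed-point iteration from `x`. It lies below every supersolution, hence
  -- below `x`, and so is itself a supersolution.
  let w : Fin n → ℝ := fun i => ((B.mulPow x i + b i) / s) ^ ((k : ℝ)⁻¹)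
  have harg : ∀ i, 0 ≤ (B.mulPow x i + b i) / s := fun i =>
    div_nonneg (add_nonneg (mulPow_nonneg hB hx0 i) (hb i)) hs.le
  have hw0 : 0 ≤ w := fun i => Real.rpow_nonneg (harg i) _
  have hwk : ∀ i, s * w i ^ k = B.mulPow x i + b i := fun i => by
    rw [Real.rpow_inv_natCast_pow (harg i) hk0, mul_div_cancel₀ _ hs.ne']
  have hwx : w ≤ x := le_csInf hne fun u hu i => by
    refine le_of_pow_le_pow_left₀ hk0 (hu.1 i) (le_of_mul_le_mul_left ?_ hs)
    rw [hwk i]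
    exact (add_le_add_left (mulPow_mono hB hx0 (hxle u hu) i) _).trans (hu.2 i)
  have hwmem : w ∈ B.superSolutions s b := ⟨hw0, fun i => by
    rw [hwk i]
    exact add_le_add_left (mulPow_mono hB hw0 hwx i) _⟩
  have hxw : x = w := le_antisymm (hxle w hwmem) hwx
  refine ⟨hx0, fun i => ?_⟩
  rw [← hwk i, ← hxw]

theorem superSolutions_mono {B : RealTensor (k + 1) n} {s s' : ℝ} (h : s ≤ s')
    {b : Fin n → ℝ} : B.superSolutions s b ⊆ B.superSolutions s' b := fun _ hu =>
  ⟨hu.1, fun i => (hu.2 i).trans (mul_le_mul_of_nonneg_right h (pow_nonneg (hu.1 i) k))⟩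

theorem exists_superSolutions_one_nonempty (B : RealTensor (k + 1) n) :
    ∃ s, (B.superSolutions s 1).Nonempty := by
  refine ⟨∑ i, |B.mulPow (1 : Fin n → ℝ) i + 1|, 1, zero_le_one, fun i => ?_⟩
  simpa using (le_abs_self _).trans
    (Finset.single_le_sum (f := fun i => |B.mulPow (1 : Fin n → ℝ) i + 1|)
      (fun i _ => abs_nonneg _) (Finset.mem_univ i))

/-- Doubling `u` multiplies both homogeneous terms by `2 ^ k ≥ 2` but not the constant `1`. The
slack gained pays for a slightly smaller `s`. -/
theorem exists_lt_superSolutions_one_nonempty (hk : 1 ≤ k) {B : RealTensor (k + 1) n} {s : ℝ}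
    (h : (B.superSolutions s 1).Nonempty) : ∃ s' < s, (B.superSolutions s' 1).Nonempty := by
  obtain ⟨u, hu0, hu⟩ := h
  set M : ℝ := 1 + ∑ i, u i ^ k
  have hsum : 0 ≤ ∑ i, u i ^ k := Finset.sum_nonneg fun i _ => pow_nonneg (hu0 i) k
  have hM : 0 < M := by positivity
  have h2 : (2 : ℝ) ≤ 2 ^ k := by
    simpa using pow_le_pow_right₀ (one_le_two : (1 : ℝ) ≤ 2) hk
  have h2' : (0 : ℝ) < 2 ^ k := by positivity
  refine ⟨s - 1 / (2 * M), by linarith [show 0 < 1 / (2 * M) by positivity], (2 : ℝ) • u,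
    smul_nonneg zero_le_two hu0, fun i => ?_⟩
  have hui : u i ^ k ≤ M := by
    have := Finset.single_le_sum (f := fun i => u i ^ k) (fun i _ => pow_nonneg (hu0 i) k)
      (Finset.mem_univ i)
    simp only [M]
    linarith
  have hd : 1 / (2 * M) * u i ^ k ≤ 1 / 2 := by
    calc 1 / (2 * M) * u i ^ k ≤ 1 / (2 * M) * M := by gcongr
      _ = 1 / 2 := by field_simp
  have hi := hu i
  rw [mulPow_smul]
  simp only [Pi.one_apply, Pi.smul_apply, smul_eq_mul, mul_pow] at hi ⊢
  have h3 : (2 : ℝ) ^ k * (B.mulPow u i + 1 / 2) ≤ 2 ^ k * ((s - 1 / (2 * M)) * u i ^ k) :=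
    mul_le_mul_of_nonneg_left (by linarith) h2'.le
  linarith

/-- Every number larger than the spectral radius admits a supersolution. -/
theorem superSolutions_one_nonempty (hk : 1 ≤ k) {B : RealTensor (k + 1) n}
    (hB : ∀ J, 0 ≤ B J) {s : ℝ} (hs : B.spectralRadius < s) :
    (B.superSolutions s 1).Nonempty := by
  by_contra hcon
  have hs0 : 0 < s := (spectralRadius_nonneg B).trans_lt hs
  let S : Set ℝ := {r | (B.superSolutions r 1).Nonempty}
  have hlow : ∀ r ∈ S, s ≤ r := fun r hr => by
    by_contra! hlt
    exact hcon (hr.mono (superSolutions_mono hlt.le))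
  have hbdd : BddBelow S := ⟨s, hlow⟩
  have hne : S.Nonempty := exists_superSolutions_one_nonempty B
  have hsr : s ≤ sInf S := le_csInf hne hlow
  have hnot : ¬ (B.superSolutions (sInf S) 1).Nonempty := fun h => by
    obtain ⟨r, hr, hr'⟩ := exists_lt_superSolutions_one_nonempty hk h
    exact absurd (csInf_le hbdd hr') (not_le.mpr hr)
  obtain ⟨r, -, hrlim, hr⟩ := exists_seq_tendsto_sInf hne hbdd
  -- Homogenizing the constant term to `t ^ k` lets `(x, 1)` be scaled to the compact unit sphere,
  -- even if the solutions `x` are unbounded.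
  have hnormalized : ∀ j, ∃ p ∈ Metric.sphere (0 : (Fin n → ℝ) × ℝ) 1,
      0 ≤ p ∧ ∀ i, B.mulPow p.1 i + p.2 ^ k = r j * p.1 i ^ k := fun j => by
    obtain ⟨hx0, hx⟩ := sInf_superSolutions_spec hk hB (hs0.trans_le (hlow _ (hr j)))
      zero_le_one (hr j)
    set x := sInf (B.superSolutions (r j) 1)
    have hq : ((x, 1) : (Fin n → ℝ) × ℝ) ≠ 0 := fun h => one_ne_zero (congrArg Prod.snd h)
    refine ⟨‖((x, 1) : (Fin n → ℝ) × ℝ)‖⁻¹ • (x, 1), ?_, ?_, fun i => ?_⟩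
    · rw [mem_sphere_zero_iff_norm]
      exact norm_smul_inv_norm (𝕜 := ℝ) hq
    · exact smul_nonneg (by positivity) ⟨hx0, zero_le_one⟩
    · have hi := hx i
      simp only [Prod.smul_fst, Prod.smul_snd, mulPow_smul, Pi.smul_apply, smul_eq_mul, mul_pow,
        Pi.one_apply, one_pow] at hi ⊢
      linear_combination (‖((x, 1) : (Fin n → ℝ) × ℝ)‖⁻¹ ^ k) * hi
  choose p hp hp0 hpeq using hnormalized
  obtain ⟨⟨y, t⟩, hyt, φ, hφ, hlim⟩ := (isCompact_sphere _ _).tendsto_subseq hp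
  have hnonneg : 0 ≤ (y, t) := ge_of_tendsto' hlim fun j => hp0 (φ j)
  have hy0 : 0 ≤ y := hnonneg.1
  have ht0 : 0 ≤ t := hnonneg.2
  have h1 : Tendsto (fun j => (p (φ j)).1) atTop (𝓝 y) :=
    (continuous_fst.tendsto (y, t)).comp hlim
  have h2 : Tendsto (fun j => (p (φ j)).2) atTop (𝓝 t) :=
    (continuous_snd.tendsto (y, t)).comp hlim
  have heq : ∀ i, B.mulPow y i + t ^ k = sInf S * y i ^ k := fun i => by
    refine tendsto_nhds_unique
      ((((continuous_mulPow B i).tendsto y).comp h1).add (h2.pow k)) ?_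
    refine Tendsto.congr (fun j => (hpeq (φ j) i).symm) ?_
    exact (hrlim.comp hφ.tendsto_atTop).mul ((tendsto_pi_nhds.mp h1 i).pow k)
  -- If `t = 0`, then `y` is an eigenvector for `sInf S ≥ s > ρ(B)`. If `t > 0`, then `t⁻¹ • y`
  -- shows that the infimum is attained. Both are impossible.
  rcases ht0.eq_or_lt with rfl | ht
  · have hy : y ≠ 0 := by
      rintro rfl
      have : ‖((0 : Fin n → ℝ), (0 : ℝ))‖ = 1 := mem_sphere_zero_iff_norm.mp hyt
      simp at this
    have hk0 : k ≠ 0 := by omega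
    have := le_spectralRadius B (hs0.le.trans hsr) hy fun i => by
      simpa [zero_pow hk0] using heq i
    linarith
  · refine hnot ⟨t⁻¹ • y, smul_nonneg (by positivity) hy0, fun i => le_of_eq ?_⟩
    have h3 : t⁻¹ ^ k * t ^ k = 1 := by rw [← mul_pow, inv_mul_cancel₀ ht.ne', one_pow]
    rw [mulPow_smul]
    simp only [Pi.one_apply, Pi.smul_apply, smul_eq_mul, mul_pow]
    linear_combination (t⁻¹ ^ k) * heq i - h3

theorem superSolutions_nonempty (hk : 1 ≤ k) {B : RealTensor (k + 1) n}
    (hB : ∀ J, 0 ≤ B J) {s : ℝ} (hs : B.spectralRadius < s) {b : Fin n → ℝ} (hb : 0 ≤ b) :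
    (B.superSolutions s b).Nonempty := by
  obtain ⟨u, hu0, hu⟩ := superSolutions_one_nonempty hk hB hs
  have hsum : 0 ≤ ∑ i, b i := Finset.sum_nonneg fun i _ => hb i
  set M : ℝ := 1 + ∑ i, b i
  have hM : 1 ≤ M := by simp only [M]; linarith
  refine ⟨M • u, smul_nonneg (by linarith) hu0, fun i => ?_⟩
  -- The summand `1` in `M` ensures `M ≥ 1`, hence `M ≤ M ^ k`.
  have hbi : b i ≤ M ^ k := by
    have h1 := Finset.single_le_sum (f := b) (fun i _ => hb i) (Finset.mem_univ i)
    have h2 : M ≤ M ^ k := le_self_pow₀ hM (by omega)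
    simp only [M] at h2 ⊢
    linarith
  have hi := mul_le_mul_of_nonneg_left (hu i) (pow_nonneg (zero_le_one.trans hM) k)
  rw [mulPow_smul]
  simp only [Pi.one_apply, Pi.smul_apply, smul_eq_mul, mul_pow] at hi ⊢
  linarith

end RealTensor

/-- The order of the tensor is `m = k + 1 ≥ 2`; vectors are ordered coordinatewise. -/
theorem mainTheorem8 (k n : ℕ) (hk : 1 ≤ k) (A : RealTensor (k + 1) n)
    (hA : A.IsStrongMTensor) :
    ∃ Ainv : {b : Fin n → ℝ // 0 ≤ b} → {x : Fin n → ℝ // 0 ≤ x},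
      Monotone Ainv ∧
      ∀ b : {b : Fin n → ℝ // 0 ≤ b}, A.mulPow (Ainv b : Fin n → ℝ) = (b : Fin n → ℝ) := by
  obtain ⟨B, s, hB, hs, rfl⟩ := hA
  have hne (b : {b : Fin n → ℝ // 0 ≤ b}) : (B.superSolutions s b).Nonempty :=
    RealTensor.superSolutions_nonempty hk hB hs b.2
  have hspec (b : {b : Fin n → ℝ // 0 ≤ b}) := RealTensor.sInf_superSolutions_spec hk hB
    ((RealTensor.spectralRadius_nonneg B).trans_lt hs) b.2 (hne b)
  refine ⟨fun b => ⟨sInf (B.superSolutions s b), (hspec b).1⟩, fun b b' hbb' => ?_, fun b => ?_⟩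
  -- Every supersolution for `b'` is one for `b`.
  · exact csInf_le_csInf (RealTensor.bddBelow_superSolutions B s b) (hne b') fun u hu =>
      ⟨hu.1, fun i => (add_le_add_right (hbb' i) _).trans (hu.2 i)⟩
  · funext i
    rw [RealTensor.mulPow_smul_identity_sub, ← (hspec b).2 i, add_sub_cancel_left]
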